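/- Fix an integer $d\ge 1$ and a Borel probability measure $\mu$ on $\mathbb{R}^d$. For $A\subset\mathbb{R}^d$ and $a\in\mathbb{R}^d$, let $\mathrm{rf}_aA$ be the set of all $y\in A$ such that, for some $\varepsilon>0$, the open segment from $a-\varepsilon(y-a)$ to $y+\varepsilon(y-a)$ is contained in $A$. For $\theta:\mathbb{R}^d\times\mathbb{R}^d\to[0,\infty]$ and $x\in\mathbb{R}^d$, let $$\mathrm{dom}_x\theta:=\mathrm{rf}_x\,\mathrm{conv}\{y\in\mathbb{R}^d:\theta(x,y)<\infty\}.$$ Let $\Theta$ be the set of tangent convex functions, i.e. of Borel measurable functions $\theta:\mathbb{R}^d\times\mathbb{R}^d\to[0,\infty]$ such that $\theta(x,\cdot)$ is convex and $\theta(x,x)=0$ for all $x\in\mathbb{R}^d$. Let $\Theta_\mu$ be the set of Borel measurable functions $\theta:\mathbb{R}^d\times\mathbb{R}^d\to[0,\infty]$ for which there is $\theta'\in\Theta$ such that $\theta\ge\theta'$ everywhere and, for $\mu$-a.e. $x$, $\mathrm{dom}_x\theta=\mathrm{dom}_x\theta'$ and $\theta(x,\cdot)=\theta'(x,\cdot)$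 on $\mathrm{dom}_x\theta$. A sequence $(\theta_n)_{n\ge1}$ of functions $\mathbb{R}^d\times\mathbb{R}^d\to[0,\infty]$ is said to converge to $\theta$ in the $\mu\otimes\mathrm{pw}$ sense if, for $\mu$-a.e. $x$, $\mathrm{dom}_x(\liminf_{n\to\infty}\theta_n)=\mathrm{dom}_x\theta$ and $\theta_n(x,y)\to\theta(x,y)$ for all $y\in\mathrm{dom}_x\theta$. Proposition 3.7. Let $(\theta_n)_{n\ge1}\subset\Theta_\mu$. Then there exist finite convex combinations $\widehat\theta_n\in\mathrm{conv}(\theta_k,\,k\ge n)$, $n\ge1$ (with constant weights and the convention $0\cdot\infty=0$), and a function $\widehat\theta_\infty\in\Theta_\mu$ such that $\widehat\theta_n\to\widehat\theta_\infty$ in the $\mu\otimes\mathrm{pw}$ sense as $n\to\infty$. -/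

import Mathlib

open MeasureTheory Filter Topology
open scoped NNReal ENNReal

/-- The Euclidean space `ℝ^d`. -/
abbrev Eucl (d : ℕ) : Type := EuclideanSpace ℝ (Fin d)

/-- The face of `A` relative to `a`: the points `y` of `A` such that, for some `ε > 0`, the open
segment from `a - ε (y - a)` to `y + ε (y - a)` is contained in `A`. -/
def relFace {d : ℕ} (a : Eucl d) (A : Set (Eucl d)) : Set (Eucl d) :=
  {y | y ∈ A ∧ ∃ ε : ℝ, 0 < ε ∧ openSegment ℝ (a - ε • (y - a)) (y + ε • (y - a)) ⊆ A}

/-- The effective domain `dom θ(x, ·)`, the set of points where the `[0, ∞]`-valued function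
`θ(x, ·)` is finite. -/
def sectionDom {d : ℕ} (θ : Eucl d × Eucl d → ℝ≥0∞) (x : Eucl d) : Set (Eucl d) :=
  {y | θ (x, y) ≠ ∞}

/-- `dom_x θ`, the face relative to `x` of the convex hull of `dom θ(x, ·)`. -/
def domAt {d : ℕ} (θ : Eucl d × Eucl d → ℝ≥0∞) (x : Eucl d) : Set (Eucl d) :=
  relFace x (convexHull ℝ (sectionDom θ x))

/-- `θ₁ = θ₂`, `μ ⊗ pw`. -/
def EqPw {d : ℕ} (μ : Measure (Eucl d)) (θ₁ θ₂ : Eucl d × Eucl d → ℝ≥0∞) : Prop :=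
  ∀ᵐ x ∂μ, domAt θ₁ x = domAt θ₂ x ∧ ∀ y ∈ domAt θ₁ x, θ₁ (x, y) = θ₂ (x, y)

/-- The set `Θ` of tangent convex functions: Borel measurable `θ : ℝ^d × ℝ^d → [0, ∞]` with
`θ(x, ·)` convex and `θ(x, x) = 0` for every `x`. Convexity of a `[0, ∞]`-valued function is
expressed with nonnegative weights, which act on `ℝ≥0∞` with `0 * ∞ = 0`. -/
def tangentConvex (d : ℕ) : Set (Eucl d × Eucl d → ℝ≥0∞) :=
  {θ | Measurable θ ∧
    ∀ x, ConvexOn ℝ≥0 Set.univ (fun y => θ (x, y)) ∧ θ (x, x) = 0}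

/-- The set `Θ_μ` of Borel measurable `θ : ℝ^d × ℝ^d → [0, ∞]` such that `θ = θ'`, `μ ⊗ pw`, and
`θ ≥ θ'` everywhere, for some tangent convex function `θ'`. -/
def tangentConvexAE {d : ℕ} (μ : Measure (Eucl d)) : Set (Eucl d × Eucl d → ℝ≥0∞) :=
  {θ | Measurable θ ∧ ∃ θ' ∈ tangentConvex d, EqPw μ θ θ' ∧ θ' ≤ θ}

/-- The pointwise lower limit of a sequence of `[0, ∞]`-valued functions. -/
noncomputable def lowerLimit {d : ℕ} (θ : ℕ → Eucl d × Eucl d → ℝ≥0∞) :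
    Eucl d × Eucl d → ℝ≥0∞ :=
  fun ω => liminf (fun n => θ n ω) atTop

/-- The sequence `θ n` converges to `θlim` in the sense `μ ⊗ pw`. -/
def TendstoPw {d : ℕ} (μ : Measure (Eucl d)) (θ : ℕ → Eucl d × Eucl d → ℝ≥0∞)
    (θlim : Eucl d × Eucl d → ℝ≥0∞) : Prop :=
  ∀ᵐ x ∂μ, domAt (lowerLimit θ) x = domAt θlim x ∧
    ∀ y ∈ domAt θlim x, Tendsto (fun n => θ n (x, y)) atTop (𝓝 (θlim (x, y)))

/-- `conv(θ_k, k ≥ n)`: the finite convex combinations of the functions `θ k`, `k ≥ n`, with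
constant weights (a zero weight cancels the value `∞`). -/
def forwardConv {d : ℕ} (θ : ℕ → Eucl d × Eucl d → ℝ≥0∞) (n : ℕ) :
    Set (Eucl d × Eucl d → ℝ≥0∞) :=
  {f | ∃ (s : Finset ℕ) (w : ℕ → ℝ≥0), (∀ k ∈ s, n ≤ k) ∧ ∑ k ∈ s, w k = 1 ∧
    f = fun ω => ∑ k ∈ s, (w k : ℝ≥0∞) * θ k ω}

/-! Work with the tangent convex minorants of the given functions. For fixed `x`, track convex
functions through their infima over basic open sets `B j`, restricted to an affine subspace `x + H`.
These infima are midpoint concave in the function, and this drives a Komlós argument: for `u = 1 /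
(1 + inf)`, the value at a midpoint satisfies `u(mid)² ≤ u(f) u(g)`, so near-minimisers of `∫ u²`
over forward convex combinations are Cauchy in `L²`. Hence all infima converge for a.e. `x`
(`exists_forwardConv_tendsto_iInf`). The infima are a.e. measurable because analytic sets are
universally measurable.

Convergent infima amount to epi-convergence, which for convex functions gives pointwise convergence
in the interior, relative to `H`, of the domain `K` of the epi-limit
(`tendsto_of_tendsto_iInf_basis`). Let `C` be the hull of the domain of the lower limit, translated
to the origin. If `K` is a neighbourhood of `0` in `H`, the relative face of `C` lies in that
interior and convergence holds there. Otherwise the lineality space of the cone generated by `K` is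
strictly smaller than `H` and still contains this face (`exists_submodule_or_tendsto`). Passing to
further forward combinations raises the lower limit, so nothing achieved is lost; the dimension can
drop only finitely often.

Finally the same weights are applied to the original functions. At a point of the limiting face the
two combinations agree for large `n`, because the point lies strictly inside a segment on which the
minorants of positive weight are finite. The limit is the upper limit of the combined minorants,
which is tangent convex. -/

/-! ### Universal measurability of analytic sets and measurability of infima over sections -/

/-- Continuity from below lets the coordinates be bounded one at a time while the image keeps
measure above `c`. The sequences obeying all the bounds form a compact set, and outer regularity
compares its image with those of the finite stages. -/
theorem exists_isCompact_image_measure_le {α : Type*} [TopologicalSpace α]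
    [MeasurableSpace α] {μ : Measure α} [μ.OuterRegular]
    {f : (ℕ → ℕ) → α} (hf : Continuous f) {c : ℝ≥0∞} (hc : c < μ (Set.range f)) :
    ∃ K : Set (ℕ → ℕ), IsCompact K ∧ c ≤ μ (f '' K) := by
  have step : ∀ (k : ℕ) (P : {P : Set (ℕ → ℕ) // c < μ (f '' P)}),
      ∃ n, c < μ (f '' (P.1 ∩ {σ | σ k ≤ n})) := by
    intro k P
    have h1 : f '' P.1 = ⋃ n, f '' (P.1 ∩ {σ | σ k ≤ n}) := by
      rw [← Set.image_iUnion, ← Set.inter_iUnion]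
      have : (⋃ n, {σ : ℕ → ℕ | σ k ≤ n}) = Set.univ := by
        ext σ; simp only [Set.mem_iUnion, Set.mem_ofPred_eq, Set.mem_univ, iff_true]
        exact ⟨σ k, le_rfl⟩
      rw [this, Set.inter_univ]
    have h2 : Monotone fun n => f '' (P.1 ∩ {σ | σ k ≤ n}) := by
      intro n m hnm
      refine Set.image_mono (Set.inter_subset_inter_right _ ?_)
      intro σ hσ
      exact le_trans hσ hnm
    have h3 := P.2
    rw [h1, h2.measure_iUnion] at h3
    exact lt_iSup_iff.1 h3
  choose g hg using step
  let S : ℕ → {P : Set (ℕ → ℕ) // c < μ (f '' P)} := fun k =>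
    Nat.rec ⟨Set.univ, by rwa [Set.image_univ]⟩ (fun k P => ⟨_, hg k P⟩) k
  let N : ℕ → ℕ := fun k => g k (S k)
  have hS : ∀ k, (S k).1 = {σ | ∀ i < k, σ i ≤ N i} := by
    intro k
    induction k with
    | zero => ext σ; simp [S]
    | succ k ih =>
      have : (S (k + 1)).1 = (S k).1 ∩ {σ | σ k ≤ N k} := rfl
      rw [this, ih]
      ext σ
      simp only [Set.mem_inter_iff, Set.mem_ofPred_eq]
      constructor
      · rintro ⟨h1, h2⟩ i hi
        rcases Nat.lt_succ_iff_lt_or_eq.1 hi with h | rfl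
        · exact h1 i h
        · exact h2
      · intro h
        exact ⟨fun i hi => h i (by omega), h k (by omega)⟩
  have hK : IsCompact {σ : ℕ → ℕ | ∀ i, σ i ≤ N i} := by
    have := isCompact_univ_pi (s := fun i => Set.Iic (N i))
      (fun i => (Set.finite_Iic (N i)).isCompact)
    convert this using 1
    ext σ; simp [Pi.le_def]
  refine ⟨_, hK, ?_⟩
  rw [Set.measure_eq_iInf_isOpen]
  refine le_iInf fun U => le_iInf fun hU => le_iInf fun hUo => ?_
  -- Otherwise pick a bad point at each stage. Truncating all coordinates by `N` gives a sequence in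
  -- the compact set; each coordinate is eventually unaffected, so the bad points themselves
  -- subconverge into `f ⁻¹' U`.
  have hex : ∃ k, (S k).1 ⊆ f ⁻¹' U := by
    by_contra hcon
    push Not at hcon
    have : ∀ k, ∃ σ ∈ (S k).1, σ ∉ f ⁻¹' U := fun k => Set.not_subset.1 (hcon k)
    choose σ hσ hσU using this
    obtain ⟨τ, hτ, φ, hφ, hlim⟩ := hK.tendsto_subseq (x := fun k i => min (σ k i) (N i))
      (fun k i => min_le_right _ _)
    have hlim' : Tendsto (fun k => σ (φ k)) atTop (𝓝 τ) := by
      rw [tendsto_pi_nhds] at hlim ⊢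
      intro i
      refine (hlim i).congr' ?_
      filter_upwards [eventually_gt_atTop i] with k hk
      have h1 := hσ (φ k)
      rw [hS] at h1
      exact min_eq_left (h1 i (lt_of_lt_of_le hk (hφ.id_le k)))
    have hmem : f ⁻¹' U ∈ 𝓝 τ := (hUo.preimage hf).mem_nhds (hU ⟨τ, hτ, rfl⟩)
    obtain ⟨k, hk⟩ := (hlim'.eventually hmem).exists
    exact hσU _ hk
  obtain ⟨k, hk⟩ := hex
  exact ((S k).2.le).trans (measure_mono (Set.image_subset_iff.2 hk))

/-- Analytic sets are universally measurable. -/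
theorem MeasureTheory.AnalyticSet.nullMeasurableSet' {α : Type*} [TopologicalSpace α] [T2Space α]
    [MeasurableSpace α] [OpensMeasurableSpace α] {μ : Measure α} [IsFiniteMeasure μ]
    [μ.OuterRegular] {s : Set α} (hs : AnalyticSet s) : NullMeasurableSet s μ := by
  have key : ∀ c < μ s, ∃ t, MeasurableSet t ∧ t ⊆ s ∧ c ≤ μ t := by
    intro c hc
    rw [AnalyticSet] at hs
    rcases hs with rfl | ⟨f, hf, rfl⟩
    · simp at hc
    · obtain ⟨K, hK, hcK⟩ := exists_isCompact_image_measure_le hf hc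
      exact ⟨_, (hK.image hf).isClosed.measurableSet, Set.image_subset_range _ _, hcK⟩
  rcases eq_or_ne (μ s) 0 with h0 | h0
  · exact NullMeasurableSet.of_null h0
  obtain ⟨u, -, hu, hulim⟩ := exists_seq_strictMono_tendsto' (pos_iff_ne_zero.2 h0)
  choose t ht hts hut using fun n => key (u n) (hu n).2
  have hT : MeasurableSet (⋃ n, t n) := MeasurableSet.iUnion ht
  have hTs : (⋃ n, t n) ⊆ s := Set.iUnion_subset hts
  have hμ : μ s ≤ μ (⋃ n, t n) :=
    le_of_tendsto' hulim fun n => (hut n).trans (measure_mono (Set.subset_iUnion t n))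
  have := ae_eq_of_subset_of_measure_ge hTs hμ hT.nullMeasurableSet (measure_ne_top μ _)
  exact NullMeasurableSet.congr hT.nullMeasurableSet this

/-- The set where the infimum is below `c` is the projection of a Borel set, hence analytic. -/
theorem aemeasurable_iInf_section {X Z : Type*}
    [TopologicalSpace X] [PolishSpace X] [MeasurableSpace X] [BorelSpace X]
    [TopologicalSpace Z] [PolishSpace Z] [MeasurableSpace Z] [BorelSpace Z]
    (μ : Measure X) [IsFiniteMeasure μ] {f : X × Z → ℝ≥0∞} (hf : Measurable f)
    {S : Set (X × Z)} (hS : MeasurableSet S) :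
    AEMeasurable (fun x => ⨅ (z : Z) (_ : (x, z) ∈ S), f (x, z)) μ := by
  let _ := TopologicalSpace.upgradeIsCompletelyMetrizable X
  have key : ∀ c, NullMeasurableSet
      ((fun x => ⨅ (z : Z) (_ : (x, z) ∈ S), f (x, z)) ⁻¹' Set.Iio c) μ := by
    intro c
    have h : (fun x => ⨅ (z : Z) (_ : (x, z) ∈ S), f (x, z)) ⁻¹' Set.Iio c
        = Prod.fst '' (S ∩ f ⁻¹' Set.Iio c) := by
      ext x
      simp only [Set.mem_preimage, Set.mem_Iio, iInf_lt_iff, Set.mem_image, Set.mem_inter_iff]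
      constructor
      · rintro ⟨z, hz, h⟩
        exact ⟨(x, z), ⟨hz, h⟩, rfl⟩
      · rintro ⟨⟨x', z⟩, ⟨hz, h⟩, rfl⟩
        exact ⟨z, hz, h⟩
    rw [h]
    exact ((hS.inter (hf measurableSet_Iio)).analyticSet.image_of_continuous
      continuous_fst).nullMeasurableSet'
  exact NullMeasurable.aemeasurable (measurable_of_Iio key)

/-! ### A Komlós argument in `L²` -/

/-- By the arithmetic-geometric mean inequality, `(1 + a)(1 + b) ≤ (1 + c)²`. The transform `1 / (1
+ ·)` also compactifies `[0, ∞]`, so no integrability is needed later. -/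
theorem ENNReal.inv_one_add_toReal_sq_le {a b c : ℝ≥0∞} (h : a + b ≤ 2 * c) :
    ((1 + c)⁻¹).toReal ^ 2 ≤ ((1 + a)⁻¹).toReal * ((1 + b)⁻¹).toReal := by
  rcases eq_or_ne c ⊤ with rfl | hc
  · simp only [add_top, inv_top, toReal_zero]
    rw [zero_pow two_ne_zero]
    positivity
  have hab : a + b ≠ ⊤ := ne_top_of_le_ne_top (mul_ne_top ofNat_ne_top hc) h
  have ha : a ≠ ⊤ := fun h => hab (by simp [h])
  have hb : b ≠ ⊤ := fun h => hab (by simp [h])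
  lift a to ℝ≥0 using ha
  lift b to ℝ≥0 using hb
  lift c to ℝ≥0 using hc
  have h' : (a : ℝ) + b ≤ 2 * c := by exact_mod_cast h
  simp only [toReal_inv, toReal_add one_ne_top coe_ne_top, toReal_one, coe_toReal]
  rw [← mul_inv]
  have := a.coe_nonneg
  have := b.coe_nonneg
  rw [inv_pow]
  apply inv_anti₀ (by positivity)
  nlinarith [sq_nonneg ((a : ℝ) - b)]

theorem ENNReal.exists_tendsto_of_inv_one_add {a : ℕ → ℝ≥0∞} {l : ℝ}
    (h : Tendsto (fun n => ((1 + a n)⁻¹).toReal) atTop (𝓝 l)) :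
    ∃ b, Tendsto a atTop (𝓝 b) := by
  have hle : ∀ n, (1 + a n)⁻¹ ≤ 1 := fun n => ENNReal.inv_le_one.2 le_self_add
  have h1 : Tendsto (fun n => (1 + a n)⁻¹) atTop (𝓝 (ENNReal.ofReal l)) := by
    refine ((ENNReal.continuous_ofReal.tendsto l).comp h).congr fun n => ?_
    exact ENNReal.ofReal_toReal (ne_top_of_le_ne_top one_ne_top (hle n))
  have h2 : Tendsto (fun n => 1 + a n) atTop (𝓝 (ENNReal.ofReal l)⁻¹) := by
    exact (((continuous_inv (G := ℝ≥0∞)).tendsto _).comp h1).congr fun n => inv_inv _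
  refine ⟨(ENNReal.ofReal l)⁻¹ - 1, ?_⟩
  refine (ENNReal.Tendsto.sub h2 tendsto_const_nhds (Or.inr one_ne_top)).congr fun n => ?_
  exact ENNReal.add_sub_cancel_left one_ne_top

/-- A Komlós type lemma for midpoint concave functionals with values in `[0, ∞]`. -/
theorem exists_seq_tendsto_ae_of_midpoint_concave {X α : Type*} [MeasurableSpace X]
    (μ : Measure X) [IsFiniteMeasure μ] {C : ℕ → Set α} (hanti : Antitone C)
    (hne : ∀ n, (C n).Nonempty) {mid : α → α → α}
    (hmid : ∀ n, ∀ f ∈ C n, ∀ g ∈ C n, mid f g ∈ C n) {m : α → X → ℝ≥0∞}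
    (hm : ∀ f ∈ C 0, AEMeasurable (m f) μ)
    (hconc : ∀ f g x, m f x + m g x ≤ 2 * m (mid f g) x) :
    ∃ F : ℕ → α, (∀ n, F n ∈ C n) ∧
      ∀ᵐ x ∂μ, ∃ l, Tendsto (fun n => m (F n) x) atTop (𝓝 l) := by
  set u : α → X → ℝ := fun f x => ((1 + m f x)⁻¹).toReal with hu
  have hu0 : ∀ f x, 0 ≤ u f x := fun f x => ENNReal.toReal_nonneg
  have hu1 : ∀ f x, u f x ≤ 1 := fun f x =>
    ENNReal.toReal_le_of_le_ofReal zero_le_one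
      (by simp)
  have hC0 : ∀ {n f}, f ∈ C n → f ∈ C 0 := fun {n f} hf => hanti (Nat.zero_le n) hf
  have hmeas : ∀ f ∈ C 0, AEStronglyMeasurable (u f) μ := fun f hf =>
    (((hm f hf).const_add 1).inv.ennreal_toReal).aestronglyMeasurable
  have hint : ∀ f ∈ C 0, ∀ g ∈ C 0, Integrable (fun x => u f x * u g x) μ := by
    intro f hf g hg
    refine Integrable.of_bound ((hmeas f hf).mul (hmeas g hg)) 1 (Eventually.of_forall fun x => ?_)
    rw [Real.norm_of_nonneg (mul_nonneg (hu0 f x) (hu0 g x))]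
    exact mul_le_one₀ (hu1 f x) (hu0 g x) (hu1 g x)
  set J : α → ℝ := fun f => ∫ x, u f x * u f x ∂μ with hJ
  have hJ0 : ∀ f, 0 ≤ J f := fun f => integral_nonneg fun x => mul_self_nonneg _
  have hJ1 : ∀ f ∈ C 0, J f ≤ μ.real Set.univ := by
    intro f hf
    have : J f ≤ ∫ x, (1 : ℝ) ∂μ := integral_mono (hint f hf f hf) (integrable_const _) fun x =>
      mul_le_one₀ (hu1 f x) (hu0 f x) (hu1 f x)
    simpa using this
  set I : ℕ → ℝ := fun n => sInf (J '' C n) with hI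
  have hbdd : ∀ n, BddBelow (J '' C n) := fun n => ⟨0, by rintro _ ⟨f, -, rfl⟩; exact hJ0 f⟩
  have hIJ : ∀ n, ∀ f ∈ C n, I n ≤ J f := fun n f hf => csInf_le (hbdd n) ⟨f, hf, rfl⟩
  have hImono : Monotone I := fun n k hnk =>
    csInf_le_csInf (hbdd n) ((hne k).image J) (Set.image_mono (hanti hnk))
  have hIbdd : BddAbove (Set.range I) := by
    refine ⟨μ.real Set.univ, ?_⟩
    rintro _ ⟨n, rfl⟩
    obtain ⟨f, hf⟩ := hne n
    exact (hIJ n f hf).trans (hJ1 f (hC0 hf))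
  obtain ⟨L, hL⟩ : ∃ L, Tendsto I atTop (𝓝 L) := ⟨_, tendsto_atTop_ciSup hImono hIbdd⟩
  have hIL : ∀ n, I n ≤ L := fun n => hImono.ge_of_tendsto hL n
  -- With error `(1 / 4) ^ k`, squared distances are below `4 * (1 / 4) ^ k`, so the norms are below
  -- the summable `2 * (1 / 2) ^ k`, which gives a.e. convergence without a subsequence.
  have hchoose : ∀ k : ℕ, ∃ N ≥ k, ∃ f ∈ C N, L - (1 / 4) ^ k < I N ∧ J f < L + (1 / 4) ^ k := by
    intro k
    have hε : (0 : ℝ) < (1 / 4) ^ k := by positivity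
    obtain ⟨N, h1, h2⟩ := ((hL.eventually (lt_mem_nhds (sub_lt_self L hε))).and
      (eventually_ge_atTop k)).exists
    obtain ⟨_, ⟨f, hf, rfl⟩, h3⟩ := exists_lt_of_csInf_lt ((hne N).image J)
      (show sInf (J '' C N) < L + (1 / 4) ^ k from (hIL N).trans_lt (by linarith))
    exact ⟨N, h2, f, hf, h1, h3⟩
  choose N hNk F hFC hF1 hF2 using hchoose
  have hF0 : ∀ k, F k ∈ C 0 := fun k => hC0 (hFC k)
  have hpow : ∀ {k n : ℕ}, k ≤ n → ((1 : ℝ) / 4) ^ n ≤ (1 / 4) ^ k := fun h =>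
    pow_le_pow_of_le_one (by norm_num) (by norm_num) h
  have hdist : ∀ k n l, k ≤ n → k ≤ l →
      ∫ x, (u (F n) x - u (F l) x) ^ 2 ∂μ < 4 * (1 / 4) ^ k := by
    intro k n l hkn hkl
    have hadd : Integrable (fun x => u (F n) x * u (F n) x + u (F l) x * u (F l) x) μ :=
      (hint _ (hF0 _) _ (hF0 _)).add (hint _ (hF0 _) _ (hF0 _))
    have e1 : ∫ x, (u (F n) x - u (F l) x) ^ 2 ∂μ
        = J (F n) + J (F l) - 2 * ∫ x, u (F n) x * u (F l) x ∂μ := by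
      rw [hJ, ← integral_const_mul]
      simp only
      rw [← integral_add (hint _ (hF0 _) _ (hF0 _)) (hint _ (hF0 _) _ (hF0 _)),
        ← integral_sub hadd ((hint _ (hF0 _) _ (hF0 _)).const_mul 2)]
      refine integral_congr_ae (Eventually.of_forall fun x => ?_)
      simp only
      ring
    have hmidC : mid (F n) (F l) ∈ C (min (N n) (N l)) :=
      hmid _ _ (hanti (min_le_left _ _) (hFC n)) _ (hanti (min_le_right _ _) (hFC l))
    -- The midpoint stays in the convex class, so the cross term is bounded below by an infimum
    -- close to `L`.
    have e2 : J (mid (F n) (F l)) ≤ ∫ x, u (F n) x * u (F l) x ∂μ := by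
      refine integral_mono (hint _ (hC0 hmidC) _ (hC0 hmidC)) (hint _ (hF0 _) _ (hF0 _)) fun x => ?_
      have := ENNReal.inv_one_add_toReal_sq_le (hconc (F n) (F l) x)
      rwa [sq] at this
    have e3 : L - (1 / 4) ^ k < I (min (N n) (N l)) := by
      rcases min_choice (N n) (N l) with h | h <;> rw [h]
      · linarith [hF1 n, hpow hkn]
      · linarith [hF1 l, hpow hkl]
    linarith [hIJ _ _ hmidC, hF2 n, hF2 l, hpow hkn, hpow hkl]
  refine ⟨F, fun n => hanti (hNk n) (hFC n), ?_⟩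
  have hae : ∀ᵐ x ∂μ, ∃ l : ℝ, Tendsto (fun n => u (F n) x) atTop (𝓝 l) := by
    refine Lp.ae_tendsto_of_cauchy_eLpNorm (p := 2) (B := fun k => ENNReal.ofReal (2 * (1 / 2) ^ k))
      (fun n => hmeas _ (hF0 n)) (by norm_num) ?_ ?_
    · rw [← ENNReal.ofReal_tsum_of_nonneg (fun k => by positivity)
        ((summable_geometric_of_lt_one (by norm_num) (by norm_num)).mul_left 2)]
      exact ENNReal.ofReal_ne_top
    · intro k n l hkn hkl
      have hLp : MemLp (u (F n) - u (F l)) 2 μ := by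
        refine MemLp.of_bound ((hmeas _ (hF0 n)).sub (hmeas _ (hF0 l))) 1
          (Eventually.of_forall fun x => ?_)
        rw [Pi.sub_apply, Real.norm_eq_abs, abs_le]
        constructor <;> linarith [hu0 (F n) x, hu0 (F l) x, hu1 (F n) x, hu1 (F l) x]
      rw [hLp.eLpNorm_eq_integral_rpow_norm (by norm_num) (by norm_num)]
      refine (ENNReal.ofReal_lt_ofReal_iff (by positivity)).2 ?_
      have := hdist k n l hkn hkl
      simp only [Pi.sub_apply, ENNReal.toReal_ofNat, Real.norm_eq_abs]
      rw [← one_div, ← Real.sqrt_eq_rpow, Real.sqrt_lt' (by positivity)]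
      refine lt_of_eq_of_lt ?_ (this.trans_eq ?_)
      · refine integral_congr_ae (Eventually.of_forall fun x => ?_)
        simp
      · rw [mul_pow, ← pow_mul, mul_comm k 2, pow_mul]
        norm_num
  filter_upwards [hae] with x hx
  obtain ⟨l, hl⟩ := hx
  exact ENNReal.exists_tendsto_of_inv_one_add hl

/-! ### Extended nonnegative convex functions -/

/-- Convexity of a `[0, ∞]`-valued function on a real vector space, with real weights. -/
def ENNConvex {E : Type*} [AddCommGroup E] [Module ℝ E] (F : E → ℝ≥0∞) : Prop :=
  ∀ p q : E, ∀ a b : ℝ, 0 ≤ a → 0 ≤ b → a + b = 1 →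
    F (a • p + b • q) ≤ ENNReal.ofReal a * F p + ENNReal.ofReal b * F q

theorem ConvexOn.ennConvex {E : Type*} [AddCommGroup E] [Module ℝ E] {F : E → ℝ≥0∞}
    (hF : ConvexOn ℝ≥0 Set.univ F) : ENNConvex F := by
  intro p q a b ha hb hab
  lift a to ℝ≥0 using ha
  lift b to ℝ≥0 using hb
  have := hF.2 (Set.mem_univ p) (Set.mem_univ q) (zero_le (a := a)) (zero_le (a := b))
    (by exact_mod_cast hab)
  simpa [ENNReal.smul_def, NNReal.smul_def] using this

namespace ENNConvex

variable {E : Type*} [AddCommGroup E] [Module ℝ E] {F : E → ℝ≥0∞}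

theorem ofReal_mul_add_le {u v c : ℝ≥0∞} {a b : ℝ} (ha : 0 ≤ a) (hb : 0 ≤ b) (hab : a + b = 1)
    (hu : u ≤ c) (hv : v ≤ c) : ENNReal.ofReal a * u + ENNReal.ofReal b * v ≤ c := by
  calc ENNReal.ofReal a * u + ENNReal.ofReal b * v
      ≤ ENNReal.ofReal a * c + ENNReal.ofReal b * c := by gcongr
    _ = c := by rw [← add_mul, ← ENNReal.ofReal_add ha hb, hab, ENNReal.ofReal_one, one_mul]

theorem convex_le (hF : ENNConvex F) (c : ℝ≥0∞) : Convex ℝ {y | F y ≤ c} :=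
  fun p hp q hq a b ha hb hab => (hF p q a b ha hb hab).trans (ofReal_mul_add_le ha hb hab hp hq)

end ENNConvex

theorem ENNReal.limsup_add_le' {ι : Type*} {l : Filter ι} (u v : ι → ℝ≥0∞) :
    limsup (fun i => u i + v i) l ≤ limsup u l + limsup v l := by
  refine ENNReal.le_of_forall_pos_le_add fun ε hε hfin => ?_
  have hε' : (ε / 2 : ℝ≥0∞) ≠ 0 := by simpa using hε.ne'
  have hu := eventually_lt_of_limsup_lt
    (ENNReal.lt_add_right (ne_top_of_le_ne_top hfin.ne le_self_add) hε')
  have hv := eventually_lt_of_limsup_lt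
    (ENNReal.lt_add_right (ne_top_of_le_ne_top hfin.ne le_add_self) hε')
  refine limsup_le_of_le (by isBoundedDefault) ?_
  filter_upwards [hu, hv] with i h1 h2
  calc u i + v i ≤ (limsup u l + ε / 2) + (limsup v l + ε / 2) := add_le_add h1.le h2.le
    _ = _ := by rw [add_add_add_comm, ENNReal.add_halves]

/-! ### Relative faces -/

section relFace

variable {d : ℕ} {a y : Eucl d} {A B : Set (Eucl d)}

theorem relFace_mono (h : A ⊆ B) : relFace a A ⊆ relFace a B :=
  fun _ hy => ⟨h hy.1, hy.2.imp fun _ hε => ⟨hε.1, hε.2.trans h⟩⟩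

theorem add_smul_mem_openSegment {x v : Eucl d} {r s t : ℝ} (hr : r < t) (hs : t < s) :
    x + t • v ∈ openSegment ℝ (x + r • v) (x + s • v) := by
  have h : 0 < s - r := by linarith
  refine ⟨(s - t) / (s - r), (t - r) / (s - r), div_pos (by linarith) h, div_pos (by linarith) h,
    ?_, ?_⟩
  · field_simp
    ring
  · have e : (s - t) / (s - r) + (t - r) / (s - r) = 1 := by field_simp; ring
    have e2 : (s - t) / (s - r) * r + (t - r) / (s - r) * s = t := by field_simp; ring
    calc _ = ((s - t) / (s - r) + (t - r) / (s - r)) • x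
          + ((s - t) / (s - r) * r + (t - r) / (s - r) * s) • v := by module
      _ = _ := by rw [e, e2, one_smul]

theorem Convex.add_smul_mem_of_le {x v : Eucl d} {r s t : ℝ} (hA : Convex ℝ A)
    (h1 : x + r • v ∈ A) (h2 : x + s • v ∈ A) (hr : r ≤ t) (hs : t ≤ s) : x + t • v ∈ A := by
  rcases hr.eq_or_lt with rfl | hr
  · exact h1
  rcases hs.eq_or_lt with rfl | hs
  · exact h2
  exact hA.openSegment_subset h1 h2 (add_smul_mem_openSegment hr hs)

/-- For convex sets the segment condition reduces to its two end points; passing to `ε / 2` is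
needed because the defining segment is open. -/
theorem Convex.mem_relFace_iff (hA : Convex ℝ A) :
    y ∈ relFace a A ↔
      ∃ ε : ℝ, 0 < ε ∧ a + (-ε) • (y - a) ∈ A ∧ a + (1 + ε) • (y - a) ∈ A := by
  have e1 : ∀ ε : ℝ, a - ε • (y - a) = a + (-ε) • (y - a) := fun ε => by module
  have e2 : ∀ ε : ℝ, y + ε • (y - a) = a + (1 + ε) • (y - a) := fun ε => by module
  constructor
  · rintro ⟨-, ε, hε, h⟩
    rw [e1, e2] at h
    exact ⟨ε / 2, by positivity, h (add_smul_mem_openSegment (by linarith) (by linarith)),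
      h (add_smul_mem_openSegment (by linarith) (by linarith))⟩
  · rintro ⟨ε, hε, h1, h2⟩
    refine ⟨?_, ε, hε, ?_⟩
    · have := hA.add_smul_mem_of_le h1 h2 (t := 1) (by linarith) (by linarith)
      rwa [one_smul, add_sub_cancel] at this
    · rw [e1, e2]
      exact hA.openSegment_subset h1 h2

/-- The face is open along lines through `a`: each point strictly inside the witnessing segment has
room left on both sides. -/
theorem Convex.exists_mem_relFace (hA : Convex ℝ A) (hy : y ∈ relFace a A) :
    ∃ ε : ℝ, 0 < ε ∧ a + (-ε) • (y - a) ∈ relFace a A ∧ a + (1 + ε) • (y - a) ∈ relFace a A := by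
  obtain ⟨ε, hε, h1, h2⟩ := hA.mem_relFace_iff.1 hy
  have key : ∀ t : ℝ, -ε < t → t < 1 + ε → a + t • (y - a) ∈ relFace a A := by
    intro t ht1 ht2
    rw [hA.mem_relFace_iff, add_sub_cancel_left]
    have hM : 0 < |t| + 1 := by positivity
    set δ := min (ε + t) (1 + ε - t) with hδ
    have hδ0 : 0 < min δ ε := lt_min (lt_min (by linarith) (by linarith)) hε
    refine ⟨min δ ε / (|t| + 1), by positivity, ?_, ?_⟩
    all_goals
      have hb : |min δ ε / (|t| + 1) * t| ≤ min δ ε := by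
        rw [abs_mul, abs_of_pos (div_pos hδ0 hM), div_mul_eq_mul_div, div_le_iff₀ hM]
        nlinarith [abs_nonneg t]
      have hb1 := abs_le.1 hb
      have hd1 : min δ ε ≤ ε := min_le_right _ _
      have hd2 : min δ ε ≤ ε + t := (min_le_left _ _).trans (min_le_left _ _)
      have hd3 : min δ ε ≤ 1 + ε - t := (min_le_left _ _).trans (min_le_right _ _)
      rw [smul_smul]
      refine hA.add_smul_mem_of_le h1 h2 ?_ ?_ <;> linarith
  exact ⟨ε / 2, by positivity, key _ (by linarith) (by linarith), key _ (by linarith) (by linarith)⟩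

/-- The end points of a slightly extended segment are themselves in the face, hence in `B`. This
upgrades finiteness on a face to an inclusion of faces. -/
theorem Convex.relFace_subset_relFace (hA : Convex ℝ A) (hB : Convex ℝ B) (h : relFace a A ⊆ B) :
    relFace a A ⊆ relFace a B := by
  intro y hy
  obtain ⟨ε, hε, h1, h2⟩ := hA.exists_mem_relFace hy
  exact hB.mem_relFace_iff.2 ⟨ε, hε, h h1, h h2⟩

end relFace

/-! ### Forward convex combinations -/

section forwardConv

variable {d : ℕ} {θ θ₁ θ₂ : ℕ → Eucl d × Eucl d → ℝ≥0∞} {f g : Eucl d × Eucl d → ℝ≥0∞} {n : ℕ}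
  {c : ℝ≥0∞} {ω : Eucl d × Eucl d}

theorem forwardConv_antitone : Antitone (forwardConv θ) := by
  rintro n m hnm f ⟨s, w, hs, hw, rfl⟩
  exact ⟨s, w, fun k hk => hnm.trans (hs k hk), hw, rfl⟩

theorem self_mem_forwardConv (n : ℕ) : θ n ∈ forwardConv θ n :=
  ⟨{n}, fun _ => 1, by simp, by simp, by simp⟩

theorem sum_mem_forwardConv {s : Finset ℕ} {v : ℕ → ℝ≥0} (hv : ∑ k ∈ s, v k = 1)
    {g : ℕ → Eucl d × Eucl d → ℝ≥0∞} (hg : ∀ k ∈ s, g k ∈ forwardConv θ n) :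
    (fun ω => ∑ k ∈ s, (v k : ℝ≥0∞) * g k ω) ∈ forwardConv θ n := by
  classical
  choose! t w ht hw hgw using hg
  have hsub : ∀ k ∈ s, s.biUnion t ∩ t k = t k := fun k hk =>
    Finset.inter_eq_right.2 (Finset.subset_biUnion_of_mem t hk)
  refine ⟨s.biUnion t, fun l => ∑ k ∈ s, v k * (if l ∈ t k then w k l else 0), ?_, ?_, ?_⟩
  · intro l hl
    obtain ⟨k, hk, hl⟩ := Finset.mem_biUnion.1 hl
    exact ht k hk l hl
  · rw [Finset.sum_comm, ← hv]
    refine Finset.sum_congr rfl fun k hk => ?_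
    rw [← Finset.mul_sum, Finset.sum_ite_mem, hsub k hk, hw k hk, mul_one]
  · funext ω
    simp only [ENNReal.ofNNReal_finsetSum, ENNReal.coe_mul, Finset.sum_mul]
    rw [Finset.sum_comm]
    refine Finset.sum_congr rfl fun k hk => ?_
    rw [hgw k hk]
    simp only [mul_assoc]
    rw [← Finset.mul_sum]
    congr 1
    rw [← hsub k hk, ← Finset.sum_ite_mem, hsub k hk]
    refine Finset.sum_congr rfl fun l _ => ?_
    split_ifs <;> simp

theorem forwardConv_trans (h₁ : ∀ k, θ₁ k ∈ forwardConv θ k) (hf : f ∈ forwardConv θ₁ n) :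
    f ∈ forwardConv θ n := by
  obtain ⟨s, w, hs, hw, rfl⟩ := hf
  exact sum_mem_forwardConv hw fun k hk => forwardConv_antitone (hs k hk) (h₁ k)

theorem average_mem_forwardConv (hf : f ∈ forwardConv θ n) (hg : g ∈ forwardConv θ n) :
    (fun ω => 2⁻¹ * f ω + 2⁻¹ * g ω) ∈ forwardConv θ n := by
  have := sum_mem_forwardConv (s := Finset.range 2) (v := fun _ => 2⁻¹)
    (g := fun k => if k = 0 then f else g) (θ := θ) (n := n)
    (by simp) (by intro k _; split_ifs <;> assumption)
  simpa [Finset.sum_range_succ] using this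

theorem le_of_mem_forwardConv (hf : f ∈ forwardConv θ n) (h : ∀ k ≥ n, c ≤ θ k ω) : c ≤ f ω := by
  obtain ⟨s, w, hs, hw, rfl⟩ := hf
  calc c = ∑ k ∈ s, (w k : ℝ≥0∞) * c := by
        rw [← Finset.sum_mul, ← ENNReal.ofNNReal_finsetSum, hw, ENNReal.coe_one, one_mul]
    _ ≤ _ := Finset.sum_le_sum fun k hk => by gcongr; exact h k (hs k hk)

theorem mem_forwardConv_le (hf : f ∈ forwardConv θ n) (h : ∀ k ≥ n, θ k ω ≤ c) : f ω ≤ c := by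
  obtain ⟨s, w, hs, hw, rfl⟩ := hf
  calc _ ≤ ∑ k ∈ s, (w k : ℝ≥0∞) * c := Finset.sum_le_sum fun k hk => by
        gcongr; exact h k (hs k hk)
    _ = c := by rw [← Finset.sum_mul, ← ENNReal.ofNNReal_finsetSum, hw, ENNReal.coe_one, one_mul]

/-- A lower bound for the whole tail passes to its convex combinations. Thus refining a sequence can
only shrink the domain of its lower limit. -/
theorem liminf_le_liminf_forwardConv (h₁ : ∀ k, θ₁ k ∈ forwardConv θ k) (ω : Eucl d × Eucl d) :
    liminf (fun n => θ n ω) atTop ≤ liminf (fun n => θ₁ n ω) atTop := by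
  refine le_of_forall_lt fun c hc => ?_
  obtain ⟨c', hc, hc'⟩ := exists_between hc
  refine hc.trans_le (le_liminf_of_le (by isBoundedDefault) ?_)
  obtain ⟨N, hN⟩ := eventually_atTop.1 (eventually_lt_of_lt_liminf hc')
  filter_upwards [eventually_ge_atTop N] with n hn
  exact le_of_mem_forwardConv (h₁ n) fun k hk => (hN k (hn.trans hk)).le

theorem limsup_forwardConv_le_limsup (h₁ : ∀ k, θ₁ k ∈ forwardConv θ k) (ω : Eucl d × Eucl d) :
    limsup (fun n => θ₁ n ω) atTop ≤ limsup (fun n => θ n ω) atTop := by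
  refine le_of_forall_gt fun c hc => ?_
  obtain ⟨c', hc, hc'⟩ := exists_between hc
  refine lt_of_le_of_lt (limsup_le_of_le (by isBoundedDefault) ?_) hc'
  obtain ⟨N, hN⟩ := eventually_atTop.1 (eventually_lt_of_limsup_lt hc)
  filter_upwards [eventually_ge_atTop N] with n hn
  exact mem_forwardConv_le (h₁ n) fun k hk => (hN k (hn.trans hk)).le

theorem tendsto_forwardConv (h₁ : ∀ k, θ₁ k ∈ forwardConv θ k) {l : ℝ≥0∞}
    (hl : Tendsto (fun n => θ n ω) atTop (𝓝 l)) : Tendsto (fun n => θ₁ n ω) atTop (𝓝 l) :=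
  tendsto_of_le_liminf_of_limsup_le
    (hl.liminf_eq.symm.le.trans (liminf_le_liminf_forwardConv h₁ ω))
    ((limsup_forwardConv_le_limsup h₁ ω).trans hl.limsup_eq.le)

theorem lowerLimit_le_lowerLimit (h₁ : ∀ k, θ₁ k ∈ forwardConv θ k) :
    lowerLimit θ ≤ lowerLimit θ₁ := liminf_le_liminf_forwardConv h₁

theorem sectionDom_anti {f g : Eucl d × Eucl d → ℝ≥0∞} (h : f ≤ g) (x : Eucl d) :
    sectionDom g x ⊆ sectionDom f x := fun y hy => ne_top_of_le_ne_top hy (h (x, y))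

theorem domAt_anti {f g : Eucl d × Eucl d → ℝ≥0∞} (h : f ≤ g) (x : Eucl d) :
    domAt g x ⊆ domAt f x := relFace_mono (convexHull_mono (sectionDom_anti h x))

theorem forwardConv_subset_tangentConvex (hθ : ∀ n, θ n ∈ tangentConvex d) :
    forwardConv θ n ⊆ tangentConvex d := by
  rintro f ⟨s, w, -, -, rfl⟩
  refine ⟨Finset.measurable_sum _ fun k _ => (hθ k).1.const_mul _, fun x => ⟨⟨convex_univ, ?_⟩, ?_⟩⟩
  · intro p _ q _ a b ha hb hab
    simp only [Finset.smul_sum, ← Finset.sum_add_distrib]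
    refine Finset.sum_le_sum fun k _ => ?_
    calc (w k : ℝ≥0∞) * θ k (x, a • p + b • q)
        ≤ w k * (a • θ k (x, p) + b • θ k (x, q)) := by
          gcongr
          exact ((hθ k).2 x).1.2 (Set.mem_univ p) (Set.mem_univ q) ha hb hab
      _ = _ := by simp only [ENNReal.smul_def, smul_eq_mul]; ring
  · exact Finset.sum_eq_zero fun k _ => by rw [((hθ k).2 x).2, mul_zero]

/-- Convexity survives upper limits, by subadditivity of the limsup, whereas lower limits need not
be convex. -/
theorem limsup_mem_tangentConvex (hθ : ∀ n, θ n ∈ tangentConvex d) :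
    (fun ω => limsup (fun n => θ n ω) atTop) ∈ tangentConvex d := by
  refine ⟨Measurable.limsup fun n => (hθ n).1, fun x => ⟨⟨convex_univ, ?_⟩, ?_⟩⟩
  · intro p _ q _ a b ha hb hab
    simp only [ENNReal.smul_def, smul_eq_mul]
    rw [← ENNReal.limsup_const_mul_of_ne_top ENNReal.coe_ne_top,
      ← ENNReal.limsup_const_mul_of_ne_top ENNReal.coe_ne_top]
    refine le_trans ?_ (ENNReal.limsup_add_le' _ _)
    refine limsup_le_limsup (Eventually.of_forall fun n => ?_)
    exact ((hθ n).2 x).1.2 (Set.mem_univ p) (Set.mem_univ q) ha hb hab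
  · simp only [((hθ _).2 x).2]
    exact limsup_const _

end forwardConv

/-! ### From epi-convergence to pointwise convergence -/

section Pointwise

variable {E : Type*} [NormedAddCommGroup E] [NormedSpace ℝ E]

/-- A point in the interior of a convex hull of finitely many points stays, with a uniform
neighbourhood, in the convex hull of the points after a small perturbation. -/
theorem exists_ball_subset_convexHull_of_perturbation {ι : Type*} [Finite ι] {b : ι → E} {v : E}
    (hv : v ∈ interior (convexHull ℝ (Set.range b))) :
    ∃ δ > 0, ∃ r > 0, ∀ z : ι → E, (∀ i, dist (b i) (z i) < δ) →
      Metric.ball v r ⊆ convexHull ℝ (Set.range z) := by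
  obtain ⟨R, hR, hball⟩ := Metric.mem_nhds_iff.1 (mem_interior_iff_mem_nhds.1 hv)
  set r := R / 2 with hr
  have hr0 : 0 < r := by positivity
  refine ⟨r / 2, by positivity, r, hr0, fun z hz w hw => ?_⟩
  by_contra hwz
  obtain ⟨φ, u, hφ, huw⟩ := geometric_hahn_banach_closed_point (convex_convexHull ℝ (Set.range z))
    ((Set.finite_range z).isClosed_convexHull (𝕜 := ℝ)) hwz
  have hne : (Set.range b).Nonempty := by
    rw [← convexHull_nonempty_iff (𝕜 := ℝ)]
    exact ⟨v, interior_subset hv⟩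
  obtain ⟨_, i0, rfl⟩ := hne
  have hz0 : ∀ i, φ (z i) < u := fun i => hφ _ (subset_convexHull ℝ _ ⟨i, rfl⟩)
  have hφ0 : 0 < ‖φ‖ := by
    rw [norm_pos_iff]
    rintro rfl
    have := hz0 i0
    simp only [zero_apply] at this huw
    linarith
  -- All `b i` satisfy `φ ≤ u + ‖φ‖ r / 2`, but `w + r • e` lies in the larger ball, hence in their
  -- hull, and violates this bound.
  obtain ⟨e, he1, he2⟩ : ∃ e : E, ‖e‖ < 1 ∧ ‖φ‖ / 2 < φ e := by
    obtain ⟨e, he1, he2⟩ := φ.exists_lt_apply_of_lt_opNorm (half_lt_self hφ0)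
    rcases le_total 0 (φ e) with h | h
    · exact ⟨e, he1, by rwa [Real.norm_of_nonneg h] at he2⟩
    · exact ⟨-e, by rwa [norm_neg], by rw [Real.norm_of_nonpos h] at he2; rwa [map_neg]⟩
  have hw' : w + r • e ∈ Metric.ball v R := by
    rw [Metric.mem_ball, dist_eq_norm] at hw ⊢
    calc ‖w + r • e - v‖ = ‖(w - v) + r • e‖ := by congr 1; abel
      _ ≤ ‖w - v‖ + ‖r • e‖ := norm_add_le _ _
      _ < r + r := by
        rw [norm_smul, Real.norm_of_nonneg hr0.le]
        nlinarith
      _ = R := by rw [hr]; ring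
  have hsub : convexHull ℝ (Set.range b) ⊆ {y | φ y ≤ u + ‖φ‖ * (r / 2)} := by
    refine convexHull_min ?_ (convex_halfSpace_le φ.toLinearMap.isLinear _)
    rintro _ ⟨i, rfl⟩
    have h1 : φ (b i) = φ (z i) + φ (b i - z i) := by rw [map_sub]; ring
    have h2 : φ (b i - z i) ≤ ‖φ‖ * (r / 2) := by
      refine (le_abs_self _).trans ((φ.le_opNorm _).trans ?_)
      have := (hz i).le
      rw [dist_eq_norm] at this
      gcongr
    simp only [Set.mem_ofPred_eq]
    linarith [hz0 i]
  have h3 := hsub (hball hw')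
  simp only [Set.mem_ofPred_eq, map_add, map_smul, smul_eq_mul] at h3
  nlinarith

/-- A convex set in finite dimension which absorbs every line through the origin is a
neighbourhood of the origin. -/
theorem Convex.mem_nhds_zero_of_absorbing [FiniteDimensional ℝ E] {K : Set E} (hK : Convex ℝ K)
    (h : ∀ v : E, ∃ t : ℝ, 0 < t ∧ t • v ∈ K ∧ (-t) • v ∈ K) : K ∈ 𝓝 0 := by
  have h0 : (0 : E) ∈ K := by
    obtain ⟨t, -, ht, -⟩ := h 0
    simpa using ht
  have hspan : affineSpan ℝ K = ⊤ := by
    rw [eq_top_iff]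
    intro v _
    obtain ⟨t, ht, hv, -⟩ := h v
    have := AffineMap.lineMap_mem t⁻¹ (subset_affineSpan ℝ K h0) (subset_affineSpan ℝ K hv)
    simpa [AffineMap.lineMap_apply, smul_smul, ht.ne'] using this
  -- The origin lies strictly between an interior point `p` and the point `-t • p` of `K`.
  obtain ⟨p, hp⟩ := hK.interior_nonempty_iff_affineSpan_eq_top.2 hspan
  obtain ⟨t, ht, -, hpt⟩ := h p
  refine mem_interior_iff_mem_nhds.1
    (hK.openSegment_interior_self_subset_interior hp hpt ⟨t / (1 + t), 1 / (1 + t), by positivity,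
      by positivity, by field_simp; ring, ?_⟩)
  rw [smul_smul, ← add_smul]
  have : t / (1 + t) + 1 / (1 + t) * -t = 0 := by field_simp; ring
  rw [this, zero_smul]

variable {ι : Type*} {B : ι → Set E} {f : ℕ → E → ℝ≥0∞} {m : ι → ℝ≥0∞}

/-- The set is the domain of the epi-limit, the supremum of `m j` over basic sets containing `v`;
near-minimisers close to `p` and `q` combine to one close to the combination. Natural number bounds
keep the condition countable for measurability. -/
theorem convex_epiLimit_dom (hBo : ∀ j, IsOpen (B j))
    (hB : ∀ v : E, ∀ U ∈ 𝓝 v, ∃ j, v ∈ B j ∧ B j ⊆ U) (hf : ∀ n, ENNConvex (f n))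
    (hm : ∀ j, Tendsto (fun n => ⨅ z ∈ B j, f n z) atTop (𝓝 (m j))) :
    Convex ℝ {v | ∃ c : ℕ, ∀ j, v ∈ B j → m j ≤ c} := by
  rintro p ⟨c₁, hp⟩ q ⟨c₂, hq⟩ a b ha hb hab
  refine ⟨max c₁ c₂, fun j hj => le_of_forall_gt_imp_ge_of_dense fun c hc => ?_⟩
  have hcont : Continuous fun z : E × E => a • z.1 + b • z.2 := by fun_prop
  have hmem : (fun z : E × E => a • z.1 + b • z.2) ⁻¹' B j ∈ 𝓝 (p, q) :=
    hcont.continuousAt.preimage_mem_nhds ((hBo j).mem_nhds hj)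
  rw [nhds_prod_eq, mem_prod_iff] at hmem
  obtain ⟨U, hU, W, hW, hUW⟩ := hmem
  obtain ⟨j₁, hj₁, hjU⟩ := hB p U hU
  obtain ⟨j₂, hj₂, hjW⟩ := hB q W hW
  have hc1 : m j₁ < c := ((hp j₁ hj₁).trans (by exact_mod_cast le_max_left _ _)).trans_lt hc
  have hc2 : m j₂ < c := ((hq j₂ hj₂).trans (by exact_mod_cast le_max_right _ _)).trans_lt hc
  refine le_of_tendsto (hm j) ?_
  filter_upwards [(hm j₁).eventually (gt_mem_nhds hc1), (hm j₂).eventually (gt_mem_nhds hc2)]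
    with n h1 h2
  obtain ⟨z₁, hz₁, h1⟩ := by simpa only [iInf_lt_iff, exists_prop] using h1
  obtain ⟨z₂, hz₂, h2⟩ := by simpa only [iInf_lt_iff, exists_prop] using h2
  refine (iInf₂_le (a • z₁ + b • z₂) (hUW (Set.mk_mem_prod (hjU hz₁) (hjW hz₂)))).trans ?_
  exact (hf n).convex_le c h1.le h2.le ha hb hab

/-- Convergence of the infima over the sets of a base (epi-convergence) of convex functions implies
pointwise convergence in the interior of the domain of the limit. -/
theorem tendsto_of_tendsto_iInf_basis [FiniteDimensional ℝ E]
    (hB : ∀ v : E, ∀ U ∈ 𝓝 v, ∃ j, v ∈ B j ∧ B j ⊆ U) (hf : ∀ n, ENNConvex (f n))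
    (hm : ∀ j, Tendsto (fun n => ⨅ z ∈ B j, f n z) atTop (𝓝 (m j))) {v : E}
    (hv : v ∈ interior {v | ∃ c : ℕ, ∀ j, v ∈ B j → m j ≤ c}) :
    ∃ l, l ≠ ∞ ∧ Tendsto (fun n => f n v) atTop (𝓝 l) := by
  obtain ⟨b, hvb, hb⟩ := exists_mem_interior_convexHull_affineBasis
    (mem_interior_iff_mem_nhds.1 hv)
  obtain ⟨δ, hδ, r, hr, hpert⟩ := exists_ball_subset_convexHull_of_perturbation hvb
  choose c hc using fun i => hb (subset_convexHull ℝ (Set.range b) (Set.mem_range_self i))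
  -- `M` is strictly above the bounds at all vertices of a simplex around `v`, so eventually each `f
  -- n` is at most `M` at points near the vertices, and hence on a fixed ball.
  set M : ℝ≥0∞ := ((∑ i, c i : ℕ) : ℝ≥0∞) + 1 with hM
  have hMtop : M ≠ ∞ := by rw [hM]; exact ENNReal.add_ne_top.2 ⟨ENNReal.natCast_ne_top _, by simp⟩
  choose j hjb hjδ using fun i => hB (b i) (Metric.ball (b i) δ) (Metric.ball_mem_nhds _ hδ)
  have hlt : ∀ i, m (j i) < M := by
    intro i
    refine (hc i (j i) (hjb i)).trans_lt ?_
    rw [hM]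
    have : c i ≤ ∑ i, c i := Finset.single_le_sum (fun _ _ => Nat.zero_le _) (Finset.mem_univ i)
    exact_mod_cast Nat.lt_succ_of_le this
  have hbound : ∀ᶠ n in atTop, ∀ w ∈ Metric.ball v r, f n w ≤ M := by
    filter_upwards [eventually_all.2 fun i => (hm (j i)).eventually (gt_mem_nhds (hlt i))] with n hn
    have : ∀ i, ∃ z ∈ B (j i), f n z < M := by
      simpa only [iInf_lt_iff, exists_prop] using hn
    choose z hz hzM using this
    have hsub := hpert z fun i => by
      have := hjδ i (hz i)
      rwa [Metric.mem_ball, dist_comm] at this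
    intro w hw
    refine convexHull_min ?_ ((hf n).convex_le M) (hsub hw)
    rintro _ ⟨i, rfl⟩
    exact (hzM i).le
  -- Write `v` as a combination of `z` and a point of the ball beyond `v`, with weight `t` on the
  -- latter. Taking the infimum over `z` in a small basic set bounds the oscillation by `t * M`.
  have hreflect : ∀ t : ℝ, 0 < t → t < 1 → ∀ z ∈ Metric.ball v (r * t), ∀ n,
      (∀ w ∈ Metric.ball v r, f n w ≤ M) → f n v ≤ f n z + ENNReal.ofReal t * M := by
    intro t ht ht1 z hz n hn
    have hw : v + ((1 - t) / t) • (v - z) ∈ Metric.ball v r := by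
      rw [Metric.mem_ball, dist_comm, dist_eq_norm] at hz
      rw [Metric.mem_ball, dist_eq_norm, add_sub_cancel_left, norm_smul,
        Real.norm_of_nonneg (div_nonneg (by linarith) ht.le), div_mul_eq_mul_div, div_lt_iff₀ ht]
      nlinarith [norm_nonneg (v - z)]
    have hcomb : (1 - t) • z + t • (v + ((1 - t) / t) • (v - z)) = v := by
      rw [smul_add, smul_smul, mul_div_cancel₀ _ ht.ne']
      module
    have := hf n z (v + ((1 - t) / t) • (v - z)) (1 - t) t (by linarith) ht.le (by ring)
    rw [hcomb] at this
    refine this.trans (add_le_add ?_ (by gcongr; exact hn _ hw))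
    calc ENNReal.ofReal (1 - t) * f n z ≤ 1 * f n z := by
          gcongr
          exact ENNReal.ofReal_le_one.2 (by linarith)
      _ = _ := one_mul _
  have hvM : ∀ᶠ n in atTop, f n v ≤ M := hbound.mono fun n hn => hn v (Metric.mem_ball_self hr)
  have hosc : ∀ t : ℝ, 0 < t → t < 1 →
      limsup (fun n => f n v) atTop ≤ liminf (fun n => f n v) atTop + ENNReal.ofReal t * M := by
    intro t ht ht1
    obtain ⟨i, hvi, hi⟩ := hB v (Metric.ball v (r * t)) (Metric.ball_mem_nhds _ (by positivity))
    have h1 : m i ≤ liminf (fun n => f n v) atTop := by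
      rw [← (hm i).liminf_eq]
      exact liminf_le_liminf (Eventually.of_forall fun n => iInf₂_le v hvi)
    have h2 : limsup (fun n => f n v) atTop ≤ m i + ENNReal.ofReal t * M := by
      rw [← ((hm i).add_const (ENNReal.ofReal t * M)).limsup_eq]
      refine limsup_le_limsup ?_
      filter_upwards [hbound] with n hn
      simp only [ENNReal.iInf_add]
      exact le_iInf₂ fun z hz => hreflect t ht ht1 z (hi hz) n hn
    exact h2.trans (add_le_add_left h1 _)
  have hsup : limsup (fun n => f n v) atTop ≤ M := limsup_le_of_le (by isBoundedDefault) hvM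
  refine ⟨limsup (fun n => f n v) atTop, ne_top_of_le_ne_top hMtop hsup, ?_⟩
  refine tendsto_of_le_liminf_of_limsup_le ?_ le_rfl
  have hlim : Tendsto (fun t : ℝ => liminf (fun n => f n v) atTop + ENNReal.ofReal t * M)
      (𝓝[>] 0) (𝓝 (liminf (fun n => f n v) atTop)) := by
    have : Tendsto (fun t : ℝ => ENNReal.ofReal t * M) (𝓝[>] 0) (𝓝 0) := by
      have h := ENNReal.Tendsto.mul_const (b := M)
        ((ENNReal.continuous_ofReal.tendsto 0).mono_left (nhdsWithin_le_nhds (s := Set.Ioi 0)))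
        (Or.inr hMtop)
      simpa using h
    simpa using this.const_add (liminf (fun n => f n v) atTop)
  refine ge_of_tendsto hlim ?_
  filter_upwards [Ioo_mem_nhdsGT (zero_lt_one (α := ℝ))] with t ht
  exact hosc t ht.1 ht.2

end Pointwise

/-! ### The lineality space and the face property -/

section SymmCone

variable {V : Type*} [AddCommGroup V] [Module ℝ V]

/-- The vectors along which `K` contains a segment around the origin. -/
def symmCone (K : Set V) : Set V := {v | ∃ t : ℝ, 0 < t ∧ t • v ∈ K ∧ (-t) • v ∈ K}

theorem symmCone_mono {K L : Set V} (h : K ⊆ L) : symmCone K ⊆ symmCone L :=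
  fun _ ⟨t, ht, h1, h2⟩ => ⟨t, ht, h h1, h h2⟩

theorem mem_symmCone_of_convex {K : Set V} (hK : Convex ℝ K) (h0 : (0 : V) ∈ K) {v : V} {s t : ℝ}
    (hs : 0 < s) (ht : 0 < t) (h1 : s • v ∈ K) (h2 : (-t) • v ∈ K) {r : ℝ} (hr : 0 ≤ r)
    (hrs : r ≤ s) (hrt : r ≤ t) : r • v ∈ K ∧ (-r) • v ∈ K := by
  have key : ∀ {w : V} {u : ℝ}, 0 < u → u • w ∈ K → r ≤ u → r • w ∈ K := by
    intro w u hu hw hru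
    have := hK.smul_mem_of_zero_mem h0 hw (t := r / u) ⟨by positivity, (div_le_one hu).2 hru⟩
    rwa [smul_smul, div_mul_cancel₀ _ hu.ne'] at this
  refine ⟨key hs h1 hrs, ?_⟩
  rw [neg_smul, ← smul_neg] at h2 ⊢
  exact key ht h2 hrt

/-- Countably many radii suffice, which later makes the random subspace Borel. -/
theorem mem_symmCone_iff_nat {K : Set V} (hK : Convex ℝ K) (h0 : (0 : V) ∈ K) {v : V} :
    v ∈ symmCone K ↔ ∃ n : ℕ, ((n : ℝ) + 1)⁻¹ • v ∈ K ∧ (-((n : ℝ) + 1)⁻¹) • v ∈ K := by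
  constructor
  · rintro ⟨t, ht, h1, h2⟩
    obtain ⟨n, hn⟩ := exists_nat_one_div_lt ht
    rw [one_div] at hn
    exact ⟨n, mem_symmCone_of_convex hK h0 ht ht h1 h2 (by positivity) hn.le hn.le⟩
  · rintro ⟨n, h1, h2⟩
    exact ⟨_, by positivity, h1, h2⟩

/-- The lineality space of the cone generated by a convex set containing the origin. -/
def symmSubmodule (K : Set V) (hK : Convex ℝ K) (h0 : (0 : V) ∈ K) : Submodule ℝ V where
  carrier := symmCone K
  zero_mem' := ⟨1, one_pos, by simpa, by simpa⟩
  add_mem' := by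
    rintro p q ⟨s, hs, hp1, hp2⟩ ⟨t, ht, hq1, hq2⟩
    have hr : 0 < min s t := lt_min hs ht
    obtain ⟨hp1, hp2⟩ := mem_symmCone_of_convex hK h0 hs hs hp1 hp2 hr.le (min_le_left _ _)
      (min_le_left _ _)
    obtain ⟨hq1, hq2⟩ := mem_symmCone_of_convex hK h0 ht ht hq1 hq2 hr.le (min_le_right _ _)
      (min_le_right _ _)
    refine ⟨min s t / 2, by positivity, ?_, ?_⟩
    · convert hK hp1 hq1 (a := 1 / 2) (b := 1 / 2) (by norm_num) (by norm_num) (by norm_num) using 1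
      module
    · convert hK hp2 hq2 (a := 1 / 2) (b := 1 / 2) (by norm_num) (by norm_num) (by norm_num) using 1
      module
  smul_mem' := by
    rintro c v ⟨t, ht, h1, h2⟩
    have hM : 0 < |c| + 1 := by positivity
    rcases le_total 0 c with hc | hc
    · rw [abs_of_nonneg hc] at hM
      have hle : t / (c + 1) * c ≤ t := by
        rw [div_mul_eq_mul_div, div_le_iff₀ hM]; nlinarith
      refine ⟨t / (c + 1), by positivity, ?_⟩
      rw [smul_smul, smul_smul, neg_mul]
      exact mem_symmCone_of_convex hK h0 ht ht h1 h2 (by positivity) hle hle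
    · rw [abs_of_nonpos hc] at hM
      have hle : t / (-c + 1) * -c ≤ t := by
        rw [div_mul_eq_mul_div, div_le_iff₀ hM]; nlinarith
      refine ⟨t / (-c + 1), by positivity, ?_⟩
      have := mem_symmCone_of_convex hK h0 ht ht h1 h2
        (mul_nonneg (by positivity) (neg_nonneg.2 hc)) hle hle
      rw [smul_smul, smul_smul, neg_mul]
      rw [mul_neg, neg_neg] at this
      exact this.symm

/-- This is the extremality of a face. Mixing `-t • (a • p + b • q)` with `q` in proportion `1 : t *
b` cancels `q` and leaves a negative multiple of `p` in `K`. -/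
theorem mem_symmCone_of_combo_mem {K : Set V} (hK : Convex ℝ K) (h0 : (0 : V) ∈ K) {p q : V}
    (hp : p ∈ K) (hq : q ∈ K) {a b : ℝ} (ha : 0 < a) (hb : 0 < b)
    (h : a • p + b • q ∈ symmCone K) : p ∈ symmCone K := by
  obtain ⟨t, ht, -, h2⟩ := h
  have hs : 0 < t * a / (1 + t * b) := by positivity
  have h3 : (-(t * a / (1 + t * b))) • p ∈ K := by
    convert hK h2 hq (a := 1 / (1 + t * b)) (b := t * b / (1 + t * b)) (by positivity)
      (by positivity) (by field_simp) using 1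
    have : t * b / (1 + t * b) = (1 / (1 + t * b)) * (t * b) := by ring
    rw [this, show t * a / (1 + t * b) = (1 / (1 + t * b)) * (t * a) by ring]
    module
  exact ⟨min 1 (t * a / (1 + t * b)), lt_min one_pos hs,
    mem_symmCone_of_convex hK h0 one_pos hs (by rwa [one_smul]) h3 (by positivity)
      (min_le_left _ _) (min_le_right _ _)⟩

/-- By extremality, a point of the face is a combination of points of `L` already in the face. The
implication is carried through the hull as a convex condition. -/
theorem convexHull_inter_symmCone_subset {L : Set V} (h0 : (0 : V) ∈ L) {H : Set V}
    (hH : symmCone (convexHull ℝ L) ⊆ H) :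
    convexHull ℝ L ∩ symmCone (convexHull ℝ L) ⊆ convexHull ℝ (L ∩ H) := by
  have hK := convex_convexHull ℝ L
  have h0' := subset_convexHull ℝ L h0
  have hsub : convexHull ℝ L ⊆ {v | v ∈ convexHull ℝ L ∧
      (v ∈ symmCone (convexHull ℝ L) → v ∈ convexHull ℝ (L ∩ H))} := by
    refine convexHull_min ?_ ?_
    · exact fun v hv => ⟨subset_convexHull ℝ L hv, fun h => subset_convexHull ℝ _ ⟨hv, hH h⟩⟩
    · rw [convex_iff_forall_pos]
      rintro p ⟨hp, hp'⟩ q ⟨hq, hq'⟩ a b ha hb hab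
      refine ⟨hK hp hq ha.le hb.le hab, fun h => ?_⟩
      refine (convex_convexHull ℝ _) (hp' ?_) (hq' ?_) ha.le hb.le hab
      · exact mem_symmCone_of_combo_mem hK h0' hp hq ha hb h
      · rw [add_comm] at h
        exact mem_symmCone_of_combo_mem hK h0' hq hp hb ha h
  exact fun v hv => (hsub hv.1).2 hv.2

end SymmCone

/-! ### Dimension reduction at a fixed base point -/

section Step

variable {V : Type*} [NormedAddCommGroup V] [NormedSpace ℝ V] [FiniteDimensional ℝ V]
  {ι : Type*} {B : ι → Set V} {f : ℕ → V → ℝ≥0∞} {m : ι → ℝ≥0∞} {H : Submodule ℝ V}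

/-- If convex functions epi-converge on a subspace `H` that contains the relative face of the hull
of the domain of their lower limit, then either this relative face lies in a smaller subspace, or
the functions converge pointwise on the relative face. -/
theorem exists_submodule_or_tendsto (hBo : ∀ j, IsOpen (B j))
    (hB : ∀ v : V, ∀ U ∈ 𝓝 v, ∃ j, v ∈ B j ∧ B j ⊆ U) (hf : ∀ n, ENNConvex (f n))
    (hf0 : ∀ n, f n 0 = 0)
    (hm : ∀ j, Tendsto (fun n => ⨅ z ∈ B j ∩ (H : Set V), f n z) atTop (𝓝 (m j)))
    {C : Set V} (hCdef : C = convexHull ℝ {v | liminf (fun n => f n v) atTop ≠ ∞})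
    (hC : symmCone C ⊆ H) :
    ∃ H' : Submodule ℝ V,
      (∀ v, v ∈ H' ↔ v ∈ H ∧ ∃ n : ℕ,
        (∃ c : ℕ, ∀ j, ((n : ℝ) + 1)⁻¹ • v ∈ B j → m j ≤ c) ∧
        (∃ c : ℕ, ∀ j, (-((n : ℝ) + 1)⁻¹) • v ∈ B j → m j ≤ c)) ∧
      symmCone C ⊆ H' ∧
      (Module.finrank ℝ H' < Module.finrank ℝ H ∨
        ∀ v, (∃ ε : ℝ, 0 < ε ∧ (-ε) • v ∈ C ∧ (1 + ε) • v ∈ C) →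
          ∃ l, l ≠ ∞ ∧ Tendsto (fun n => f n v) atTop (𝓝 l)) := by
  set L : Set V := {v | liminf (fun n => f n v) atTop ≠ ∞} with hL
  have h0L : (0 : V) ∈ L := by simp [hL, hf0]
  set K' : Set H := {v | ∃ c : ℕ, ∀ j, v ∈ ((↑) : H → V) ⁻¹' B j → m j ≤ c} with hK'
  have hBo' : ∀ j, IsOpen (((↑) : H → V) ⁻¹' B j) := fun j =>
    (hBo j).preimage continuous_subtype_val
  have hB' : ∀ v : H, ∀ U ∈ 𝓝 v, ∃ j, v ∈ ((↑) : H → V) ⁻¹' B j ∧ ((↑) : H → V) ⁻¹' B j ⊆ U := by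
    intro v U hU
    obtain ⟨W, hW, hWU⟩ := mem_nhds_subtype (H : Set V) v U |>.1 hU
    obtain ⟨j, hj, hjW⟩ := hB v W hW
    exact ⟨j, hj, (Set.preimage_mono hjW).trans hWU⟩
  have hf' : ∀ n, ENNConvex fun v : H => f n v := fun n p q a b ha hb hab =>
    hf n p q a b ha hb hab
  have hm' : ∀ j, Tendsto (fun n => ⨅ z ∈ ((↑) : H → V) ⁻¹' B j, f n z) atTop (𝓝 (m j)) := by
    intro j
    refine (hm j).congr fun n => ?_
    refine le_antisymm (le_iInf₂ fun z hz => iInf₂_le (z : V) ⟨hz, z.2⟩) ?_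
    exact le_iInf₂ fun z hz => iInf₂_le (⟨z, hz.2⟩ : H) hz.1
  have hKconv : Convex ℝ K' := convex_epiLimit_dom hBo' hB' hf' hm'
  -- An infimum over a set containing `v` is at most the value at `v`, so the epi-limit lies below
  -- the lower limit.
  have hLK : ∀ v : H, (v : V) ∈ L → v ∈ K' := by
    intro v hv
    obtain ⟨c, hc⟩ := ENNReal.exists_nat_gt hv
    refine ⟨c, fun j hj => ?_⟩
    refine le_trans ?_ hc.le
    rw [← (hm' j).liminf_eq]
    exact liminf_le_liminf (Eventually.of_forall fun n => iInf₂_le v hj)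
  have hCconv : Convex ℝ C := hCdef ▸ convex_convexHull ℝ L
  have h0C : (0 : V) ∈ C := hCdef ▸ subset_convexHull ℝ L h0L
  have h0K : (0 : H) ∈ K' := hLK 0 h0L
  have hsub : C ∩ symmCone C ⊆ H.subtype '' K' := by
    have h1 : C ∩ symmCone C ⊆ convexHull ℝ (L ∩ H) := by
      rw [hCdef] at hC ⊢
      exact convexHull_inter_symmCone_subset h0L hC
    refine h1.trans (convexHull_min ?_ (hKconv.linear_image H.subtype))
    exact fun v hv => ⟨⟨v, hv.2⟩, hLK _ hv.1, rfl⟩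
  have hsymm : ∀ (r : ℝ) {v : V}, v ∈ symmCone C → r • v ∈ symmCone C := fun r v hv =>
    (symmSubmodule C hCconv h0C).smul_mem r hv
  refine ⟨(symmSubmodule K' hKconv h0K).map H.subtype, fun v => ?_, fun v hv => ?_, ?_⟩
  · rw [Submodule.mem_map]
    constructor
    · rintro ⟨w, hw, rfl⟩
      exact ⟨w.2, (mem_symmCone_iff_nat hKconv h0K).1 hw⟩
    · rintro ⟨hv, h⟩
      exact ⟨⟨v, hv⟩, (mem_symmCone_iff_nat hKconv h0K).2 h, rfl⟩
  · obtain ⟨t, ht, h1, h2⟩ := id hv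
    obtain ⟨w₁, hw₁, e₁⟩ := hsub ⟨h1, hsymm t hv⟩
    obtain ⟨w₂, hw₂, e₂⟩ := hsub ⟨h2, hsymm (-t) hv⟩
    refine ⟨⟨v, hC hv⟩, ⟨t, ht, ?_, ?_⟩, rfl⟩
    · have : t • (⟨v, hC hv⟩ : H) = w₁ := Subtype.ext e₁.symm
      rwa [this]
    · have : (-t) • (⟨v, hC hv⟩ : H) = w₂ := Subtype.ext e₂.symm
      rwa [this]
  · have hle : (symmSubmodule K' hKconv h0K).map H.subtype ≤ H := Submodule.map_subtype_le _ _
    rcases (Submodule.finrank_mono hle).lt_or_eq with h | h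
    · exact Or.inl h
    right
    have heq := Submodule.eq_of_le_of_finrank_eq hle h
    -- Equality of dimensions means that `K'` absorbs every line of `H`.
    have hnhds : K' ∈ 𝓝 0 := by
      refine hKconv.mem_nhds_zero_of_absorbing fun w => ?_
      obtain ⟨w', hw', e⟩ := heq.ge w.2
      rwa [Subtype.ext e] at hw'
    rintro v ⟨ε, hε, h1, h2⟩
    have hv : v ∈ symmCone C := ⟨ε, hε, mem_symmCone_of_convex hCconv h0C (s := 1 + ε)
      (by positivity) hε h2 h1 hε.le (by linarith) le_rfl⟩
    obtain ⟨w, hw, e⟩ := hsub ⟨h2, hsymm (1 + ε) hv⟩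
    -- `v` lies strictly between the interior point `0` and `(1 + ε) • v`, which is in `K'`.
    have hvint : (⟨v, hC hv⟩ : H) ∈ interior K' := by
      refine hKconv.openSegment_interior_self_subset_interior (mem_interior_iff_mem_nhds.2 hnhds) hw
        ⟨ε / (1 + ε), 1 / (1 + ε), by positivity, by positivity, by field_simp; ring, ?_⟩
      apply Subtype.ext
      have e' : (w : V) = (1 + ε) • v := e
      have hne : 1 + ε ≠ 0 := by positivity
      simp [e', smul_smul, hne]
    exact tendsto_of_tendsto_iInf_basis hB' hf' hm' hvint

end Step

/-! ### Measurable selection of subspaces and iteration -/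

section Refinement

variable {d : ℕ} {μ : Measure (Eucl d)} {θ θ₁ : ℕ → Eucl d × Eucl d → ℝ≥0∞}

theorem measurable_of_mem_forwardConv (hθ : ∀ n, Measurable (θ n)) {n : ℕ}
    {f : Eucl d × Eucl d → ℝ≥0∞} (hf : f ∈ forwardConv θ n) : Measurable f := by
  obtain ⟨s, w, -, -, rfl⟩ := hf
  exact Finset.measurable_sum _ fun k _ => (hθ k).const_mul _

/-- Some forward convex combinations epi-converge almost everywhere along the sections of a Borel
set `A`. -/
theorem exists_forwardConv_tendsto_iInf [IsFiniteMeasure μ] (hθ : ∀ n, Measurable (θ n))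
    {A : Set (Eucl d × Eucl d)} (hA : MeasurableSet A) {B : ℕ → Set (Eucl d)}
    (hB : ∀ j, IsOpen (B j)) :
    ∃ θ₁ : ℕ → Eucl d × Eucl d → ℝ≥0∞, (∀ n, θ₁ n ∈ forwardConv θ n) ∧
      ∃ M : Eucl d × ℕ → ℝ≥0∞, Measurable M ∧ ∀ᵐ x ∂μ, ∀ j,
        Tendsto (fun n => ⨅ (z : Eucl d) (_ : z ∈ B j ∧ (x, z) ∈ A), θ₁ n (x, z)) atTop
          (𝓝 (M (x, j))) := by
  -- A finite measure charging every index: one application of the Komlós lemma on the product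
  -- handles all basic sets at once, with no diagonal extraction.
  set ν : Measure ℕ := (Measure.count : Measure ℕ).toFinite with hν
  set S : Set ((Eucl d × ℕ) × Eucl d) := {p | p.2 ∈ B p.1.2 ∧ (p.1.1, p.2) ∈ A} with hS
  have hSm : MeasurableSet S := by
    have h1 : MeasurableSet {p : (Eucl d × ℕ) × Eucl d | p.2 ∈ B p.1.2} := by
      have : {p : (Eucl d × ℕ) × Eucl d | p.2 ∈ B p.1.2} =
          ⋃ j, {p : (Eucl d × ℕ) × Eucl d | p.1.2 = j} ∩ Prod.snd ⁻¹' B j := by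
        ext p
        simp
      rw [this]
      exact MeasurableSet.iUnion fun j =>
        ((measurable_snd.comp measurable_fst) (measurableSet_singleton j)).inter
          (measurable_snd (hB j).measurableSet)
    exact h1.inter (hA.preimage (by fun_prop))
  obtain ⟨F, hF, hlim⟩ := exists_seq_tendsto_ae_of_midpoint_concave (μ.prod ν)
    (C := forwardConv θ) forwardConv_antitone (fun n => ⟨_, self_mem_forwardConv n⟩)
    (mid := fun f g ω => 2⁻¹ * f ω + 2⁻¹ * g ω)
    (fun n f hf g hg => average_mem_forwardConv hf hg)
    (m := fun f p => ⨅ (z : Eucl d) (_ : (p, z) ∈ S), f (p.1, z))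
    (fun f hf => aemeasurable_iInf_section (X := Eucl d × ℕ) (Z := Eucl d) _
      (f := fun p => f (p.1.1, p.2))
      ((measurable_of_mem_forwardConv hθ hf).comp (by fun_prop)) hSm)
    (by
      intro f g p
      simp only [ENNReal.mul_iInf_of_ne two_ne_zero ENNReal.ofNat_ne_top]
      refine le_iInf₂ fun z hz => ?_
      rw [← mul_add, ← mul_assoc, ENNReal.mul_inv_cancel two_ne_zero ENNReal.ofNat_ne_top, one_mul]
      exact add_le_add (iInf₂_le z hz) (iInf₂_le z hz))
  have hae : ∀ n, AEMeasurable (fun p : Eucl d × ℕ =>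
      ⨅ (z : Eucl d) (_ : (p, z) ∈ S), F n (p.1, z)) (μ.prod ν) := fun n =>
    aemeasurable_iInf_section (X := Eucl d × ℕ) (Z := Eucl d) _
      (f := fun p => F n (p.1.1, p.2))
      ((measurable_of_mem_forwardConv hθ (hF n)).comp (by fun_prop)) hSm
  obtain ⟨M, hM, hlim⟩ := measurable_limit_of_tendsto_metrizable_ae hae hlim
  refine ⟨F, hF, M, hM, ?_⟩
  filter_upwards [Measure.ae_ae_of_ae_prod hlim] with x hx j
  rw [hν, ae_toFinite, Measure.ae_count_iff] at hx
  exact hx j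

/-- The hull of the effective domain of the lower limit at `x`, translated to the origin. -/
def lowerHull (θ : ℕ → Eucl d × Eucl d → ℝ≥0∞) (x : Eucl d) : Set (Eucl d) :=
  convexHull ℝ {v | liminf (fun n => θ n (x, x + v)) atTop ≠ ∞}

/-- The sequence converges to a finite limit on the domain of its lower limit at `x`. -/
def ConvergesAt (θ : ℕ → Eucl d × Eucl d → ℝ≥0∞) (x : Eucl d) : Prop :=
  ∀ y ∈ domAt (lowerLimit θ) x, ∃ l, l ≠ ∞ ∧ Tendsto (fun n => θ n (x, y)) atTop (𝓝 l)

theorem ConvergesAt.forwardConv {x : Eucl d} (h : ConvergesAt θ x)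
    (h₁ : ∀ k, θ₁ k ∈ forwardConv θ k) : ConvergesAt θ₁ x := by
  intro y hy
  obtain ⟨l, hl, ht⟩ := h y (domAt_anti (lowerLimit_le_lowerLimit h₁) x hy)
  exact ⟨l, hl, tendsto_forwardConv h₁ ht⟩

theorem lowerHull_anti (h₁ : ∀ k, θ₁ k ∈ forwardConv θ k) (x : Eucl d) :
    lowerHull θ₁ x ⊆ lowerHull θ x :=
  convexHull_mono fun v hv => ne_top_of_le_ne_top hv (liminf_le_liminf_forwardConv h₁ (x, x + v))

theorem mem_lowerHull_of_mem_convexHull {x v : Eucl d}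
    (h : x + v ∈ convexHull ℝ (sectionDom (lowerLimit θ) x)) : v ∈ lowerHull θ x := by
  have hsub : convexHull ℝ (sectionDom (lowerLimit θ) x) ⊆ (fun y => -x + y) ⁻¹' lowerHull θ x := by
    refine convexHull_min ?_ ((convex_convexHull ℝ _).translate_preimage_right (-x))
    intro y hy
    refine subset_convexHull ℝ _ ?_
    have : x + (-x + y) = y := by abel
    rw [Set.mem_ofPred_eq, this]
    exact hy
  simpa using hsub h

/-- One step of the reduction of the dimension of the random subspace. -/
theorem exists_forwardConv_reduction [IsFiniteMeasure μ] (hθ : ∀ n, θ n ∈ tangentConvex d)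
    {k : ℕ} {A : Set (Eucl d × Eucl d)} (hA : MeasurableSet A)
    (h : ∀ᵐ x ∂μ, ConvergesAt θ x ∨ ∃ H : Submodule ℝ (Eucl d), (∀ y, (x, y) ∈ A ↔ y - x ∈ H) ∧
      Module.finrank ℝ H + k ≤ d ∧ symmCone (lowerHull θ x) ⊆ H) :
    ∃ θ₁ : ℕ → Eucl d × Eucl d → ℝ≥0∞, (∀ n, θ₁ n ∈ forwardConv θ n) ∧
      ∃ A₁ : Set (Eucl d × Eucl d), MeasurableSet A₁ ∧
        ∀ᵐ x ∂μ, ConvergesAt θ₁ x ∨ ∃ H : Submodule ℝ (Eucl d),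
          (∀ y, (x, y) ∈ A₁ ↔ y - x ∈ H) ∧ Module.finrank ℝ H + (k + 1) ≤ d ∧
          symmCone (lowerHull θ₁ x) ⊆ H := by
  obtain ⟨b, hbc, -, hb⟩ := TopologicalSpace.exists_countable_basis (Eucl d)
  have hne : b.Nonempty := by
    obtain ⟨u, hu, -⟩ := hb.exists_subset_of_mem_open (Set.mem_univ (0 : Eucl d)) isOpen_univ
    exact ⟨u, hu⟩
  obtain ⟨B, rfl⟩ := hbc.exists_eq_range hne
  have hBo : ∀ j, IsOpen (B j) := fun j => hb.isOpen ⟨j, rfl⟩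
  obtain ⟨θ₁, hθ₁, M, hM, hlim⟩ :=
    exists_forwardConv_tendsto_iInf (μ := μ) (fun n => (hθ n).1) hA hBo
  have hmeas : ∀ g : Eucl d × Eucl d → Eucl d, Measurable g → MeasurableSet
      {p : Eucl d × Eucl d | ∃ c : ℕ, ∀ j, g p ∈ B j → M (p.1, j) ≤ c} := by
    intro g hg
    refine measurableSet_setOfPred.2 (Measurable.exists fun c => Measurable.forall fun j => ?_)
    refine Measurable.imp (measurableSet_setOfPred.1 (hg (hBo j).measurableSet)) ?_
    exact measurableSet_setOfPred.1 ((hM.comp (by fun_prop)) measurableSet_Iic)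
  have hθ₁t : ∀ n, θ₁ n ∈ tangentConvex d := fun n =>
    forwardConv_subset_tangentConvex hθ (hθ₁ n)
  -- The sections of this set are the translated lineality spaces of the epi-limit domains, written
  -- with countable operations so that it is Borel.
  refine ⟨θ₁, hθ₁, A ∩ ⋃ n : ℕ,
    {p | ∃ c : ℕ, ∀ j, p.1 + ((n : ℝ) + 1)⁻¹ • (p.2 - p.1) ∈ B j → M (p.1, j) ≤ c} ∩
    {p | ∃ c : ℕ, ∀ j, p.1 + (-((n : ℝ) + 1)⁻¹) • (p.2 - p.1) ∈ B j → M (p.1, j) ≤ c},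
    hA.inter (MeasurableSet.iUnion fun n => (hmeas _ (by fun_prop)).inter
      (hmeas _ (by fun_prop))), ?_⟩
  filter_upwards [h, hlim] with x hx hlimx
  rcases hx with hx | ⟨H, hAH, hdim, hH⟩
  · exact Or.inl (hx.forwardConv hθ₁)
  obtain ⟨H', hH', hsymm, hor⟩ := exists_submodule_or_tendsto (H := H)
    (B := fun j => (fun v => x + v) ⁻¹' B j) (f := fun n v => θ₁ n (x, x + v))
    (m := fun j => M (x, j)) (C := lowerHull θ₁ x)
    (fun j => (hBo j).preimage (by fun_prop))
    (by
      intro v U hU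
      have : (fun y => -x + y) ⁻¹' U ∈ 𝓝 (x + v) := by
        refine ContinuousAt.preimage_mem_nhds (by fun_prop) ?_
        simpa using hU
      obtain ⟨_, ⟨j, rfl⟩, hj, hjU⟩ := hb.mem_nhds_iff.1 this
      refine ⟨j, hj, fun w hw => ?_⟩
      simpa using hjU hw)
    (by
      intro n p q a b ha hb hab
      have := ((hθ₁t n).2 x).1.ennConvex (x + p) (x + q) a b ha hb hab
      have e : a • (x + p) + b • (x + q) = x + (a • p + b • q) := by
        calc _ = (a + b) • x + (a • p + b • q) := by module
          _ = _ := by rw [hab, one_smul]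
      rwa [e] at this)
    (fun n => by simpa using ((hθ₁t n).2 x).2)
    (by
      intro j
      refine (hlimx j).congr fun n => ?_
      refine le_antisymm (le_iInf₂ fun v hv => ?_) (le_iInf₂ fun z hz => ?_)
      · exact iInf₂_le (x + v) ⟨hv.1, (hAH _).2 (by simpa using hv.2)⟩
      · refine (iInf₂_le (z - x) ⟨?_, (hAH z).1 hz.2⟩).trans ?_
        · simp
        · simpa using hz.1)
    rfl ((symmCone_mono (lowerHull_anti hθ₁ x)).trans hH)
  rcases hor with hlt | hconv
  · refine Or.inr ⟨H', fun y => ?_, by omega, hsymm⟩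
    rw [hH', ← hAH]
    simp only [Set.mem_inter_iff, Set.mem_iUnion, Set.mem_ofPred_eq, Set.mem_preimage]
  · refine Or.inl fun y hy => ?_
    obtain ⟨ε, hε, h1, h2⟩ := (convex_convexHull ℝ _).mem_relFace_iff.1 hy
    obtain ⟨l, hl, ht⟩ := hconv (y - x) ⟨ε, hε, mem_lowerHull_of_mem_convexHull h1,
      mem_lowerHull_of_mem_convexHull h2⟩
    exact ⟨l, hl, by simpa using ht⟩

/-- Starting from the full space, every round lowers the dimension by at least one wherever
convergence has not yet been reached; after `d + 1` rounds no subspace is left. -/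
theorem exists_forwardConv_convergesAt [IsFiniteMeasure μ] (hθ : ∀ n, θ n ∈ tangentConvex d) :
    ∃ θ₁ : ℕ → Eucl d × Eucl d → ℝ≥0∞, (∀ n, θ₁ n ∈ forwardConv θ n) ∧
      ∀ᵐ x ∂μ, ConvergesAt θ₁ x := by
  have key : ∀ k : ℕ, ∃ θ₁ : ℕ → Eucl d × Eucl d → ℝ≥0∞, (∀ n, θ₁ n ∈ forwardConv θ n) ∧
      ∃ A : Set (Eucl d × Eucl d), MeasurableSet A ∧
        ∀ᵐ x ∂μ, ConvergesAt θ₁ x ∨ ∃ H : Submodule ℝ (Eucl d),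
          (∀ y, (x, y) ∈ A ↔ y - x ∈ H) ∧ Module.finrank ℝ H + k ≤ d ∧
          symmCone (lowerHull θ₁ x) ⊆ H := by
    intro k
    induction k with
    | zero =>
      exact ⟨θ, self_mem_forwardConv, Set.univ, MeasurableSet.univ,
        Eventually.of_forall fun x => Or.inr ⟨⊤, by simp, by simp, by simp⟩⟩
    | succ k ih =>
      obtain ⟨θ₁, hθ₁, A, hA, h⟩ := ih
      obtain ⟨θ₂, hθ₂, A₂, hA₂, h₂⟩ := exists_forwardConv_reduction
        (fun n => forwardConv_subset_tangentConvex hθ (hθ₁ n)) hA h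
      exact ⟨θ₂, fun n => forwardConv_trans hθ₁ (hθ₂ n), A₂, hA₂, h₂⟩
  obtain ⟨θ₁, hθ₁, A, -, h⟩ := key (d + 1)
  refine ⟨θ₁, hθ₁, h.mono fun x hx => hx.resolve_right ?_⟩
  rintro ⟨H, -, hdim, -⟩
  omega

end Refinement

/-! ### Return to the original functions -/

theorem mem_tangentConvexAE_of_mem_tangentConvex {d : ℕ} (μ : Measure (Eucl d))
    {θ : Eucl d × Eucl d → ℝ≥0∞} (hθ : θ ∈ tangentConvex d) : θ ∈ tangentConvexAE μ :=
  ⟨hθ.1, θ, hθ, Eventually.of_forall fun _ => ⟨rfl, fun _ _ => rfl⟩, le_rfl⟩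

/-- Convergence to finite limits makes the upper limit finite on the smaller-function face, and
openness of faces along lines through `x` gives the nontrivial inclusion. -/
theorem ConvergesAt.domAt_limsup {d : ℕ} {θ : ℕ → Eucl d × Eucl d → ℝ≥0∞} {x : Eucl d}
    (h : ConvergesAt θ x) :
    domAt (fun ω => limsup (fun n => θ n ω) atTop) x = domAt (lowerLimit θ) x := by
  refine Set.Subset.antisymm (domAt_anti (fun ω => liminf_le_limsup) x) ?_
  refine (convex_convexHull ℝ _).relFace_subset_relFace (convex_convexHull ℝ _) fun y hy => ?_
  obtain ⟨l, hl, ht⟩ := h y hy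
  refine subset_convexHull ℝ _ (?_ : limsup (fun n => θ n (x, y)) atTop ≠ ∞)
  rwa [ht.limsup_eq]

/-- A convex combination of functions that agree with tangent convex functions on their domains
agrees with the combination of the latter at points interior to a segment of finiteness. -/
theorem sum_eq_sum_of_ne_top {d : ℕ} {θ θ' : ℕ → Eucl d × Eucl d → ℝ≥0∞} {x y : Eucl d}
    (h : ∀ k, domAt (θ k) x = domAt (θ' k) x ∧ ∀ y ∈ domAt (θ k) x, θ k (x, y) = θ' k (x, y))
    {s : Finset ℕ} {w : ℕ → ℝ≥0} {ε : ℝ} (hε : 0 < ε)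
    (h1 : ∑ k ∈ s, (w k : ℝ≥0∞) * θ' k (x, x + (-ε) • (y - x)) ≠ ∞)
    (h2 : ∑ k ∈ s, (w k : ℝ≥0∞) * θ' k (x, x + (1 + ε) • (y - x)) ≠ ∞) :
    ∑ k ∈ s, (w k : ℝ≥0∞) * θ k (x, y) = ∑ k ∈ s, (w k : ℝ≥0∞) * θ' k (x, y) := by
  refine Finset.sum_congr rfl fun k hk => ?_
  rcases eq_or_ne (w k) 0 with hw | hw
  · simp [hw]
  have hfin : ∀ z, ∑ k ∈ s, (w k : ℝ≥0∞) * θ' k (x, z) ≠ ∞ →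
      z ∈ convexHull ℝ (sectionDom (θ' k) x) := by
    intro z hz
    refine subset_convexHull ℝ _ fun htop => ?_
    have := ENNReal.sum_ne_top.1 hz k hk
    rw [htop, ENNReal.mul_top (by exact_mod_cast hw)] at this
    exact this rfl
  have hy : y ∈ domAt (θ' k) x :=
    (convex_convexHull ℝ _).mem_relFace_iff.2 ⟨ε, hε, hfin _ h1, hfin _ h2⟩
  rw [(h k).2 y ((h k).1 ▸ hy)]

theorem proposition3p7 (d : ℕ) (hd : 1 ≤ d) (μ : Measure (Eucl d)) [IsProbabilityMeasure μ]
    (θ : ℕ → Eucl d × Eucl d → ℝ≥0∞) (hθ : ∀ n, θ n ∈ tangentConvexAE μ) :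
    ∃ (θhat : ℕ → Eucl d × Eucl d → ℝ≥0∞) (θlim : Eucl d × Eucl d → ℝ≥0∞),
      (∀ n, θhat n ∈ forwardConv θ n) ∧ θlim ∈ tangentConvexAE μ ∧ TendstoPw μ θhat θlim := by
  choose hmeas θ' hθ' heq hle using hθ
  obtain ⟨θ₁, hθ₁, hconv⟩ := exists_forwardConv_convergesAt (μ := μ) hθ'
  have hθ₁t := fun n => forwardConv_subset_tangentConvex hθ' (hθ₁ n)
  choose s w hs hw hsum using hθ₁
  set θhat : ℕ → Eucl d × Eucl d → ℝ≥0∞ := fun n ω => ∑ k ∈ s n, (w n k : ℝ≥0∞) * θ k ω with hhat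
  have hle₁ : ∀ n, θ₁ n ≤ θhat n := by
    intro n ω
    rw [hsum]
    exact Finset.sum_le_sum fun k _ => mul_le_mul_right (hle k ω) _
  refine ⟨θhat, fun ω => limsup (fun n => θ₁ n ω) atTop, fun n => ⟨s n, w n, hs n, hw n, rfl⟩,
    mem_tangentConvexAE_of_mem_tangentConvex μ (limsup_mem_tangentConvex hθ₁t), ?_⟩
  filter_upwards [ae_all_iff.2 heq, hconv] with x hx hc
  -- The segment from `x` to `y` extends at both ends to points of the face. There `θ₁ n` has a
  -- finite limit, hence is finite for large `n`, and `y` falls in the domain of every minorant with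
  -- nonzero weight.
  have hagree : ∀ y ∈ domAt (lowerLimit θ₁) x, ∀ᶠ n in atTop, θ₁ n (x, y) = θhat n (x, y) := by
    intro y hy
    obtain ⟨ε, hε, h1, h2⟩ := (convex_convexHull ℝ _).exists_mem_relFace hy
    obtain ⟨l₁, hl₁, ht₁⟩ := hc _ h1
    obtain ⟨l₂, hl₂, ht₂⟩ := hc _ h2
    filter_upwards [ht₁.eventually_ne hl₁, ht₂.eventually_ne hl₂] with n hn₁ hn₂
    rw [hsum] at hn₁ hn₂ ⊢
    exact (sum_eq_sum_of_ne_top hx hε hn₁ hn₂).symm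
  have htend : ∀ y ∈ domAt (lowerLimit θ₁) x, ∃ l, l ≠ ∞ ∧
      Tendsto (fun n => θ₁ n (x, y)) atTop (𝓝 l) ∧
      Tendsto (fun n => θhat n (x, y)) atTop (𝓝 l) := by
    intro y hy
    obtain ⟨l, hl, ht⟩ := hc y hy
    exact ⟨l, hl, ht, ht.congr' (hagree y hy)⟩
  -- One inclusion uses `θ₁ n ≤ θhat n` everywhere; the other uses the finite limits of `θhat n` on
  -- the face.
  have hdom : domAt (lowerLimit θhat) x = domAt (lowerLimit θ₁) x := by
    refine Set.Subset.antisymm (domAt_anti (fun ω => liminf_le_liminf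
      (Eventually.of_forall fun n => hle₁ n ω)) x) ?_
    refine (convex_convexHull ℝ _).relFace_subset_relFace (convex_convexHull ℝ _) fun y hy => ?_
    obtain ⟨l, hl, -, ht⟩ := htend y hy
    refine subset_convexHull ℝ _ (?_ : liminf (fun n => θhat n (x, y)) atTop ≠ ∞)
    rwa [ht.liminf_eq]
  rw [hc.domAt_limsup]
  refine ⟨hdom, fun y hy => ?_⟩
  obtain ⟨l, -, ht₁, ht⟩ := htend y hy
  simpa only [ht₁.limsup_eq] using ht
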